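/- Let $A\in\mathbb R^{n\times n}$ and $B\in\mathbb R^{n}$ be such that the single-input linear system $\Sigma(A,B):\ \dot x=Ax+Bu$ is (state) controllable, and suppose that all eigenvalues $\lambda_1,\dots,\lambda_n$ of $A$, listed with multiplicity, $\Lambda_n=[\lambda_1,\dots,\lambda_n]$, are negative real numbers. Let $$P_n=[B,AB,\dots,A^{n-1}B],\qquad w_1=[0,\dots,0,1]\,P_n^{-1},\qquad W_c=\begin{bmatrix} w_1\\ w_1A\\ \vdots\\ w_1A^{n-1}\end{bmatrix}^{-1},$$ and let $s^n+a_1s^{n-1}+\dots+a_n$ be the characteristic polynomial of $A$. Then $W_c$ is well defined and invertible, and it transforms $\Sigma(A,B)$ into the controllable canonical form: $W_c^{-1}AW_c=A_c$ and $W_c^{-1}B=[0,\dots,0,1]^T$, where $A_c$ has ones on the superdiagonal, last row $[-a_n,-a_{n-1},\dots,-a_1]$, and zeros elsewhere. Moreover $a_n=(-1)^n\prod_{i=1}^n\lambda_i$, and the infinite-time controllability ellipsoid $$R_b(\infty)=\Big\{\int_0^\infty e^{At}B\,z(t)\,dt \;:\; z\in L^2(0,\infty),\ \int_0^\infty z(t)^2\,dt\le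 1\Big\}\subset\mathbb R^n$$ has Lebesgue measure $$\operatorname{vol}\big(R_b(\infty)\big)=\Pi_n\left(\frac{a_n}{2^n}\right)^{1/2}\left|\frac{\det W_c}{L_n(\Lambda_n)}\right|,$$ where $$\Pi_n=\frac{\pi^{n/2}}{\Gamma\left(\frac n2+1\right)},\qquad L_n(\Lambda_n)=\Big[\prod_{1\le i<j\le n}(\lambda_i+\lambda_j)\Big]\prod_{i=1}^n\lambda_i .$$ -/

import Mathlib

open MeasureTheory Polynomial
open scoped Matrix

noncomputable section

namespace LCT

/-- State controllability of the single-input system `x' = A x + B u`: every state `x₀` can be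
steered to every state `x₁` in some finite time `T > 0` by an integrable input on `[0, T]`.
The state reached at time `T` is written by the variation-of-constants formula. -/
def IsControllable {n : ℕ} (A : Matrix (Fin n) (Fin n) ℝ) (B : Fin n → ℝ) : Prop :=
  ∀ x₀ x₁ : Fin n → ℝ, ∃ T : ℝ, 0 < T ∧ ∃ u : ℝ → ℝ, IntervalIntegrable u volume 0 T ∧
    NormedSpace.exp (T • A) *ᵥ x₀
      + ∫ t in (0 : ℝ)..T, u t • (NormedSpace.exp ((T - t) • A) *ᵥ B) = x₁

/-- The controllability matrix `[B, A B, …, A ^ (n - 1) B]`. -/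
def controllabilityMatrix {n : ℕ} (A : Matrix (Fin n) (Fin n) ℝ) (B : Fin n → ℝ) :
    Matrix (Fin n) (Fin n) ℝ :=
  Matrix.of fun i j => ((A ^ (j : ℕ)) *ᵥ B) i

/-- The last standard basis vector `[0, …, 0, 1]`; also the input vector of the controllable
canonical form. -/
def lastBasis (n : ℕ) : Fin n → ℝ := fun i => if (i : ℕ) + 1 = n then 1 else 0

/-- The row vector `[0, …, 0, 1] [B, A B, …, A ^ (n - 1) B]⁻¹`. -/
def w₁ {n : ℕ} (A : Matrix (Fin n) (Fin n) ℝ) (B : Fin n → ℝ) : Fin n → ℝ :=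
  lastBasis n ᵥ* (controllabilityMatrix A B)⁻¹

/-- The transformation matrix `W_c`: the inverse of the matrix with rows
`w₁, w₁ A, …, w₁ A ^ (n - 1)`. -/
def Wc {n : ℕ} (A : Matrix (Fin n) (Fin n) ℝ) (B : Fin n → ℝ) : Matrix (Fin n) (Fin n) ℝ :=
  (Matrix.of fun i : Fin n => w₁ A B ᵥ* (A ^ (i : ℕ)))⁻¹

/-- The state matrix of the controllable canonical form: ones on the superdiagonal and last row
`[-a_n, …, -a_1]`, where `s ^ n + a_1 s ^ (n - 1) + ⋯ + a_n` is the characteristic polynomial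
of `A`. -/
def Ac {n : ℕ} (A : Matrix (Fin n) (Fin n) ℝ) : Matrix (Fin n) (Fin n) ℝ :=
  Matrix.of fun i j =>
    if (i : ℕ) + 1 = n then -A.charpoly.coeff (j : ℕ)
    else if (j : ℕ) = (i : ℕ) + 1 then 1 else 0

/-- The infinite-time controllability ellipsoid: all states `∫₀^∞ e^{At} B z(t) dt`, where `z` is
a square-integrable input on `(0, ∞)` of total energy `∫₀^∞ z(t)² dt ≤ 1`. -/
def ellipsoid {n : ℕ} (A : Matrix (Fin n) (Fin n) ℝ) (B : Fin n → ℝ) : Set (Fin n → ℝ) :=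
  {x | ∃ z : ℝ → ℝ, MemLp z 2 (volume.restrict (Set.Ioi 0)) ∧
    ∫ t in Set.Ioi (0 : ℝ), z t ^ 2 ≤ 1 ∧
    IntegrableOn (fun t : ℝ => z t • (NormedSpace.exp (t • A) *ᵥ B)) (Set.Ioi 0) ∧
    x = ∫ t in Set.Ioi (0 : ℝ), z t • (NormedSpace.exp (t • A) *ᵥ B)}

/-- The volume coefficient of the `n`-dimensional ball, `π ^ (n / 2) / Γ (n / 2 + 1)`. -/
def ballCoeff (n : ℕ) : ℝ := Real.pi ^ ((n : ℝ) / 2) / Real.Gamma ((n : ℝ) / 2 + 1)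

/-- `L_n(Λ) = (∏_{i < j} (λ_i + λ_j)) (∏_i λ_i)`. -/
def L {n : ℕ} (Λ : Fin n → ℝ) : ℝ :=
  (∏ i : Fin n, ∏ j ∈ Finset.Ioi i, (Λ i + Λ j)) * ∏ i : Fin n, Λ i

end LCT

end

/-!
The volume is computed in a basis in which the controllability Gramian is the identity. For a
polynomial `q`, the functions `t ↦ w₁ q(A) e^{tA} B` are the inverse Laplace transforms of
`q(s) / p(s)`, with `p` the characteristic polynomial and `deg q < n`. The choice
`q_i = ∏_{j < i} (s + λ_j) ∏_{j > i} (s - λ_j)` gives the Takenaka–Malmquist system, which becomes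
orthonormal in `L²(0, ∞)` after scaling by `√(-2 λ_i)`. No distinctness of the eigenvalues is
needed. Let `S` be the matrix with rows `√(-2 λ_i) w₁ q_i(A)` (`balancingMatrix`).

* Orthonormality (`gram_of_triangular_ode`, `integral_balanced_mul`) is read off from the triangular
  differential system that the functions satisfy, which comes from the polynomial identity
  `balancedPoly_mul_X_sub_C`. The integrals converge since all responses decay exponentially
  (`response_decay`).
* Hence the ellipsoid is the preimage under `S` of the Euclidean unit ball (`ellipsoid_eq`), and its
  volume is that of the ball divided by `|det S|`.
* The determinant (`abs_det_balancingMatrix`) follows from the factorization of `S` into the diagonal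
  scaling, a triangular matrix expressing the `q_i` in Newton polynomials, whose diagonal entries
  are `∏_{j < i} (λ_i + λ_j)`, a coefficient matrix of determinant `±1`, and `W_c⁻¹`.

The canonical form itself needs only that the controllability matrix is invertible
(`isUnit_det_controllabilityMatrix`), the relations `w₁ A^j B = 0` for `j < n - 1` and
`w₁ A^{n-1} B = 1`, and the Cayley–Hamilton theorem.
-/

namespace LCT

/-! ### Newton polynomials and balanced polynomials -/

/-- The Newton polynomial `∏_{j > i} (X - λ_j)`, monic of degree `n - 1 - i`. -/
noncomputable def newtonPoly {n : ℕ} (Λ : Fin n → ℝ) (i : Fin n) : ℝ[X] :=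
  ∏ j ∈ Finset.Ioi i, (X - C (Λ j))

/-- The numerators, over the common denominator `∏_j (s - λ_j)`, of the Takenaka–Malmquist
functions (up to normalization): `∏_{j < i} (X + λ_j) ∏_{j > i} (X - λ_j)`. -/
noncomputable def balancedPoly {n : ℕ} (Λ : Fin n → ℝ) (i : Fin n) : ℝ[X] :=
  (∏ j ∈ Finset.Iio i, (X + C (Λ j))) * newtonPoly Λ i

lemma newtonPoly_eq_mul_succ {n : ℕ} (Λ : Fin n → ℝ) {i j : Fin n} (h : (j : ℕ) = i + 1) :
    newtonPoly Λ i = (X - C (Λ j)) * newtonPoly Λ j := by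
  have : Finset.Ioi i = insert j (Finset.Ioi j) := by
    ext k; simp only [Finset.mem_Ioi, Finset.mem_insert, Fin.lt_def, Fin.ext_iff]; omega
  rw [newtonPoly, this, Finset.prod_insert (by simp), newtonPoly]

lemma Iio_eq_insert {n : ℕ} {i j : Fin n} (h : (j : ℕ) = i + 1) :
    Finset.Iio j = insert i (Finset.Iio i) := by
  ext k; simp only [Finset.mem_Iio, Finset.mem_insert, Fin.lt_def, Fin.ext_iff]; omega

lemma newtonPoly_monic {n : ℕ} (Λ : Fin n → ℝ) (i : Fin n) : (newtonPoly Λ i).Monic :=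
  monic_prod_of_monic _ _ fun _ _ => monic_X_sub_C _

lemma newtonPoly_natDegree {n : ℕ} (Λ : Fin n → ℝ) (i : Fin n) :
    (newtonPoly Λ i).natDegree = n - 1 - i := by
  rw [newtonPoly, natDegree_prod_of_monic _ _ fun _ _ => monic_X_sub_C _]
  simp

lemma balancedPoly_monic {n : ℕ} (Λ : Fin n → ℝ) (i : Fin n) : (balancedPoly Λ i).Monic :=
  (monic_prod_of_monic _ _ fun _ _ => monic_X_add_C _).mul (newtonPoly_monic Λ i)

lemma balancedPoly_natDegree {n : ℕ} (Λ : Fin n → ℝ) (i : Fin n) :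
    (balancedPoly Λ i).natDegree = n - 1 := by
  rw [balancedPoly, (monic_prod_of_monic _ _ fun _ _ => monic_X_add_C _).natDegree_mul
    (newtonPoly_monic Λ i), natDegree_prod_of_monic _ _ fun _ _ => monic_X_add_C _,
    newtonPoly_natDegree]
  simp
  omega

/-- Modulo `∏_j (X - λ_j)`, multiplication by `X` acts on the polynomials `balancedPoly Λ i` by a
lower triangular matrix. -/
lemma balancedPoly_mul_X_sub_C {n : ℕ} (Λ : Fin n → ℝ) (i : Fin n) :
    balancedPoly Λ i * (X - C (Λ i)) =
      ∏ j, (X - C (Λ j)) + ∑ j ∈ Finset.Iio i, C (2 * Λ j) * balancedPoly Λ j := by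
  obtain ⟨i, hi⟩ := i
  induction i with
  | zero =>
    have h0 : Finset.Iio (⟨0, hi⟩ : Fin n) = ∅ := by
      ext k; simp [Fin.lt_def]
    have h1 : (Finset.univ : Finset (Fin n)) = insert ⟨0, hi⟩ (Finset.Ioi ⟨0, hi⟩) := by
      ext k
      simp only [Finset.mem_univ, Finset.mem_insert, Finset.mem_Ioi, Fin.lt_def, Fin.ext_iff,
        true_iff]
      omega
    rw [balancedPoly, h0, h1, Finset.prod_insert (by simp), newtonPoly]
    simp only [Finset.prod_empty, Finset.sum_empty]
    ring
  | succ i ih =>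
    have hi' : i < n := by omega
    have ih := ih hi'
    rw [Iio_eq_insert (i := ⟨i, hi'⟩) rfl, Finset.sum_insert (by simp)]
    -- consecutive balanced polynomials differ by the factor `(X + λ_i) / (X - λ_{i+1})`
    have h1 : balancedPoly Λ ⟨i + 1, hi⟩ * (X - C (Λ ⟨i + 1, hi⟩)) =
        balancedPoly Λ ⟨i, hi'⟩ * (X + C (Λ ⟨i, hi'⟩)) := by
      rw [balancedPoly, balancedPoly, Iio_eq_insert (i := ⟨i, hi'⟩) rfl,
        Finset.prod_insert (by simp),
        newtonPoly_eq_mul_succ Λ (i := ⟨i, hi'⟩) (j := ⟨i + 1, hi⟩) rfl]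
      ring
    rw [h1]
    have h2 : C (2 * Λ ⟨i, hi'⟩) = 2 * C (Λ ⟨i, hi'⟩) := by rw [C_mul, map_ofNat]
    rw [h2]
    linear_combination ih

/-- Newton interpolation of `f` at the nodes `λ_i, λ_{i-1}, …, λ_0`, written after multiplication
by `newtonPoly Λ i`. The coefficient at the first node is the value of `f` there. -/
lemma mul_newtonPoly_expansion {n : ℕ} (Λ : Fin n → ℝ) (i : Fin n) (f : ℝ[X])
    (hf : f.natDegree ≤ i) :
    ∃ c : Fin n → ℝ, c i = f.eval (Λ i) ∧ (∀ m, i < m → c m = 0) ∧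
      f * newtonPoly Λ i = ∑ m, C (c m) * newtonPoly Λ m := by
  obtain ⟨i, hi⟩ := i
  induction i generalizing f with
  | zero =>
    refine ⟨Pi.single ⟨0, hi⟩ (f.eval (Λ ⟨0, hi⟩)), by simp, fun m hm => ?_, ?_⟩
    · simp [hm.ne']
    · rw [Finset.sum_eq_single ⟨0, hi⟩ (by intro b _ hb; simp [hb]) (by simp)]
      rw [eq_C_of_natDegree_le_zero hf]; simp
  | succ i ih =>
    have hi' : i < n := by omega
    set j : Fin n := ⟨i + 1, hi⟩
    obtain ⟨c, -, hc0, hc⟩ := ih (f /ₘ (X - C (Λ j))) hi' (by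
      rw [natDegree_divByMonic _ (monic_X_sub_C _), natDegree_X_sub_C]
      change f.natDegree ≤ i + 1 at hf
      change _ ≤ i
      omega)
    have hcj : c j = 0 := hc0 _ (by simp [Fin.lt_def, j])
    refine ⟨c + Pi.single j (f.eval (Λ j)), by simp [hcj], fun m hm => ?_, ?_⟩
    · rw [Pi.add_apply, hc0 m (by simp only [Fin.lt_def, j] at hm ⊢; omega),
        Pi.single_apply, if_neg hm.ne', add_zero]
    · simp only [Pi.add_apply, C_add, add_mul, Finset.sum_add_distrib]
      rw [← hc, newtonPoly_eq_mul_succ Λ (i := ⟨i, hi'⟩) (j := j) rfl,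
        Finset.sum_eq_single j (by intro b _ hb; simp [hb]) (by simp)]
      have h := modByMonic_add_div f (X - C (Λ j))
      rw [modByMonic_X_sub_C_eq_C_eval] at h
      simp only [Pi.single_eq_same]
      linear_combination (-newtonPoly Λ j) * h

/-- The balanced polynomials are obtained from the Newton polynomials by a lower triangular
matrix with diagonal entries `∏_{j < i} (λ_i + λ_j)`. -/
lemma exists_balancedPoly_expansion {n : ℕ} (Λ : Fin n → ℝ) :
    ∃ c : Matrix (Fin n) (Fin n) ℝ,
      c.det = ∏ i : Fin n, ∏ j ∈ Finset.Ioi i, (Λ i + Λ j) ∧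
      ∀ i, balancedPoly Λ i = ∑ m, C (c i m) * newtonPoly Λ m := by
  choose c hc hc0 hsum using fun i => mul_newtonPoly_expansion Λ i
    (∏ j ∈ Finset.Iio i, (X + C (Λ j))) (by
      rw [natDegree_prod_of_monic _ _ fun _ _ => monic_X_add_C _]; simp)
  refine ⟨Matrix.of c, ?_, hsum⟩
  rw [Matrix.det_of_isLowerTriangular (Matrix.of c) (fun i j hij => hc0 i j (by simpa using hij))]
  simp only [Matrix.of_apply, hc, eval_prod, eval_add, eval_X, eval_C]
  rw [Finset.prod_comm' (t' := Finset.univ) (s' := fun j => Finset.Ioi j) (by simp)]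
  simp only [add_comm]

/-- The Newton polynomials are monic of degrees `n - 1, …, 1, 0`, so their coefficient matrix is
unitriangular after reversing the rows. -/
lemma abs_det_newtonPoly_coeff {n : ℕ} (Λ : Fin n → ℝ) :
    |(Matrix.of fun i k : Fin n => (newtonPoly Λ i).coeff k).det| = 1 := by
  have h : (Matrix.of fun k i : Fin n => (newtonPoly Λ (Fin.rev i)).coeff k).det = 1 := by
    refine Matrix.det_matrixOfPolynomials _ (fun i => ?_) (fun i => newtonPoly_monic _ _)
    rw [newtonPoly_natDegree, Fin.val_rev]; omega
  have h2 : (Matrix.of fun k i : Fin n => (newtonPoly Λ (Fin.rev i)).coeff k) =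
      ((Matrix.of fun i k : Fin n => (newtonPoly Λ i).coeff k).submatrix Fin.revPerm id)ᵀ := by
    ext; simp
  rw [h2, Matrix.det_transpose, Matrix.det_permute] at h
  have h3 := congrArg abs h
  rw [abs_mul, abs_one] at h3
  have : |(((Equiv.Perm.sign (Fin.revPerm : Equiv.Perm (Fin n)) : ℤˣ) : ℤ) : ℝ)| = 1 := by
    rcases Int.units_eq_one_or (Equiv.Perm.sign (Fin.revPerm : Equiv.Perm (Fin n))) with h | h <;>
      simp [h]
  rwa [this, one_mul] at h3

/-! ### Responses and their exponential decay -/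

section Response

/-- The scalar function `t ↦ w q(A) e^{tA} B`. It is linear in `q`, depends on `q` only modulo
the characteristic polynomial, and its time derivative is multiplication of `q` by `X`. -/
noncomputable def response {n : ℕ} (A : Matrix (Fin n) (Fin n) ℝ) (B w : Fin n → ℝ)
    (q : ℝ[X]) (t : ℝ) : ℝ :=
  w ⬝ᵥ ((aeval A q * NormedSpace.exp (t • A)) *ᵥ B)

variable {n : ℕ} (A : Matrix (Fin n) (Fin n) ℝ) (B w : Fin n → ℝ)

lemma hasDerivAt_response (q : ℝ[X]) (t : ℝ) :
    HasDerivAt (response A B w q) (response A B w (q * X) t) t := by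
  let : NormedRing (Matrix (Fin n) (Fin n) ℝ) := Matrix.linftyOpNormedRing
  let : NormedAlgebra ℝ (Matrix (Fin n) (Fin n) ℝ) := Matrix.linftyOpNormedAlgebra
  have h := hasDerivAt_exp_smul_const' (𝕂 := ℝ) A t
  let φ : Matrix (Fin n) (Fin n) ℝ →ₗ[ℝ] ℝ :=
    { toFun := fun M => w ⬝ᵥ ((aeval A q * M) *ᵥ B)
      map_add' := fun M N => by rw [mul_add, Matrix.add_mulVec, dotProduct_add]
      map_smul' := fun c M => by
        rw [mul_smul_comm, Matrix.smul_mulVec, dotProduct_smul]; rfl }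
  have h2 := (LinearMap.toContinuousLinearMap φ).hasFDerivAt.comp_hasDerivAt t h
  convert! h2 using 1
  simp only [response, map_mul, aeval_X, mul_assoc]
  rfl

lemma continuous_response (q : ℝ[X]) : Continuous (response A B w q) :=
  continuous_iff_continuousAt.2 fun t => (hasDerivAt_response A B w q t).continuousAt

lemma response_zero (q : ℝ[X]) : response A B w q 0 = w ⬝ᵥ (aeval A q *ᵥ B) := by
  simp [response]

lemma response_add (p q : ℝ[X]) (t : ℝ) :
    response A B w (p + q) t = response A B w p t + response A B w q t := by
  simp [response, add_mul, Matrix.add_mulVec]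

lemma response_C_mul (c : ℝ) (q : ℝ[X]) (t : ℝ) :
    response A B w (C c * q) t = c * response A B w q t := by
  simp [response, Algebra.algebraMap_eq_smul_one, Matrix.smul_mulVec]

lemma response_sum {ι : Type*} (s : Finset ι) (f : ι → ℝ[X]) (t : ℝ) :
    response A B w (∑ i ∈ s, f i) t = ∑ i ∈ s, response A B w (f i) t := by
  classical
  induction s using Finset.induction_on with
  | empty => simp [response]
  | insert a s ha ih => rw [Finset.sum_insert ha, response_add, ih, Finset.sum_insert ha]

lemma response_charpoly (t : ℝ) : response A B w A.charpoly t = 0 := by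
  simp [response, Matrix.aeval_self_charpoly]

/-- If `h' - l h` is `O(e^{-μt})` and `l < -μ`, then `h` is `O(e^{-μt})`. -/
lemma decay_of_deriv_sub_mul {h g : ℝ → ℝ} {l μ K : ℝ} (hμ : l + μ < 0)
    (hd : ∀ t, HasDerivAt h (l * h t + g t) t)
    (hg : ∀ t, 0 ≤ t → |g t| ≤ K * Real.exp (-μ * t)) :
    ∃ K', ∀ t, 0 ≤ t → |h t| ≤ K' * Real.exp (-μ * t) := by
  have hK : 0 ≤ K := by simpa using (abs_nonneg _).trans (hg 0 le_rfl)
  set ν := -(l + μ) with hν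
  have hνpos : 0 < ν := by simp [hν]; linarith
  refine ⟨|h 0| + K / ν, fun t ht => ?_⟩
  -- the integrating factor `e^{-ls}` removes the term `l h`
  have hf : ∀ s, HasDerivAt (fun s => Real.exp (-l * s) * h s) (Real.exp (-l * s) * g s) s := by
    intro s
    have := (((hasDerivAt_id s).const_mul (-l)).exp).mul (hd s)
    convert! this using 1
    simp; ring
  have hB : ∀ s, HasDerivAt (fun s => |h 0| + K / ν * Real.exp (ν * s))
      (K * Real.exp (ν * s)) s := by
    intro s
    have := ((((hasDerivAt_id s).const_mul ν).exp).const_mul (K / ν)).const_add (|h 0|)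
    convert! this using 1
    simp; field_simp
  have key := image_norm_le_of_norm_deriv_right_le_deriv_boundary (a := 0) (b := t)
    (f := fun s => Real.exp (-l * s) * h s) (f' := fun s => Real.exp (-l * s) * g s)
    (fun s _ => (hf s).continuousAt.continuousWithinAt) (fun s _ => (hf s).hasDerivWithinAt)
    (B := fun s => |h 0| + K / ν * Real.exp (ν * s)) (B' := fun s => K * Real.exp (ν * s))
    (by simp; positivity) hB (fun s hs => by
      rw [norm_mul, Real.norm_eq_abs, Real.norm_eq_abs, Real.abs_exp]
      calc _ ≤ Real.exp (-l * s) * (K * Real.exp (-μ * s)) := by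
            gcongr; exact hg s hs.1
        _ = K * (Real.exp (-l * s) * Real.exp (-μ * s)) := by ring
        _ = K * Real.exp (ν * s) := by rw [← Real.exp_add]; congr 2; rw [hν]; ring) ⟨ht, le_rfl⟩
  simp only [norm_mul, Real.norm_eq_abs, Real.abs_exp] at key
  have e1 : Real.exp (l * t) * Real.exp (-l * t) = 1 := by
    rw [← Real.exp_add]; simp
  have e2 : Real.exp (l * t) * Real.exp (ν * t) = Real.exp (-μ * t) := by
    rw [← Real.exp_add]; congr 1; rw [hν]; ring
  have e3 : Real.exp (l * t) ≤ Real.exp (-μ * t) := by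
    apply Real.exp_le_exp.2; nlinarith
  calc |h t| = Real.exp (l * t) * (Real.exp (-l * t) * |h t|) := by rw [← mul_assoc, e1, one_mul]
    _ ≤ Real.exp (l * t) * (|h 0| + K / ν * Real.exp (ν * t)) := by gcongr
    _ = |h 0| * Real.exp (l * t) + K / ν * Real.exp (-μ * t) := by rw [← e2]; ring
    _ ≤ |h 0| * Real.exp (-μ * t) + K / ν * Real.exp (-μ * t) := by gcongr
    _ = _ := by ring

lemma exists_rate {Λ : Fin n → ℝ} (hneg : ∀ i, Λ i < 0) : ∃ μ > 0, ∀ i, Λ i + μ < 0 := by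
  rcases isEmpty_or_nonempty (Fin n) with h | h
  · exact ⟨1, one_pos, fun i => h.elim i⟩
  · obtain ⟨i, hi⟩ := Finite.exists_max Λ
    exact ⟨-Λ i / 2, by linarith [hneg i], fun j => by linarith [hi j, hneg i]⟩

/-- With eigenvalues below `-μ`, every response is `O(e^{-μt})`: by the Cayley–Hamilton theorem it
vanishes once `q` is a multiple of all factors `X - λ_i`, and these factors can be removed one at
a time by `decay_of_deriv_sub_mul`. -/
lemma response_decay {Λ : Fin n → ℝ} (hΛ : A.charpoly = ∏ i : Fin n, (X - C (Λ i)))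
    {μ : ℝ} (hμ : ∀ i, Λ i + μ < 0) (q : ℝ[X]) :
    ∃ K, ∀ t, 0 ≤ t → |response A B w q t| ≤ K * Real.exp (-μ * t) := by
  suffices H : ∀ s : Finset (Fin n), ∃ K, ∀ t, 0 ≤ t →
      |response A B w (q * ∏ i ∈ sᶜ, (X - C (Λ i))) t| ≤ K * Real.exp (-μ * t) by
    simpa using H Finset.univ
  intro s
  induction s using Finset.induction_on with
  | empty =>
    refine ⟨0, fun t _ => ?_⟩
    rw [Finset.compl_empty, ← hΛ]
    simp [response, Matrix.aeval_self_charpoly]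
  | insert a s ha ih =>
    obtain ⟨K, hK⟩ := ih
    refine decay_of_deriv_sub_mul (hμ a) (fun t => ?_) hK
    have hs : sᶜ = insert a (insert a s)ᶜ := by
      ext k; by_cases hk : k = a <;> simp [hk, ha]
    convert! hasDerivAt_response A B w (q * ∏ i ∈ (insert a s)ᶜ, (X - C (Λ i))) t using 1
    rw [hs, Finset.prod_insert (by simp), ← response_C_mul, ← response_add]
    congr 1
    ring

end Response

/-! ### Controllability and the canonical form -/

section CanonicalForm

variable {n : ℕ} (A : Matrix (Fin n) (Fin n) ℝ) (B w : Fin n → ℝ)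

lemma dotProduct_aeval_mulVec_of_degree_lt {q : ℝ[X]} (hq : q.degree < n) :
    w ⬝ᵥ (aeval A q *ᵥ B) = ∑ j : Fin n, q.coeff j * (w ⬝ᵥ (A ^ (j : ℕ) *ᵥ B)) := by
  have h := (degree_lt_iff_coeff_zero q n).1 hq
  have : q = ∑ j ∈ Finset.range n, C (q.coeff j) * X ^ j := by
    ext m
    simp only [finsetSum_coeff, coeff_C_mul, coeff_X_pow, mul_ite, mul_one, mul_zero,
      Finset.sum_ite_eq, Finset.mem_range]
    split_ifs with hm
    · rfl
    · exact h m (by omega)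
  conv_lhs => rw [this]
  rw [Finset.sum_range, map_sum, Matrix.sum_mulVec, dotProduct_sum]
  refine Finset.sum_congr rfl fun j _ => ?_
  simp [Algebra.algebraMap_eq_smul_one, Matrix.smul_mulVec]

/-- A covector annihilating `B, AB, …, A^{n-1}B` annihilates `e^{tA}B`, because `e^{tA}` is a
polynomial in `A`, which may be reduced modulo the characteristic polynomial. -/
lemma dotProduct_exp_mulVec_eq_zero (h : ∀ j : Fin n, w ⬝ᵥ (A ^ (j : ℕ) *ᵥ B) = 0) (t : ℝ) :
    w ⬝ᵥ (NormedSpace.exp (t • A) *ᵥ B) = 0 := by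
  have hmem : NormedSpace.exp (t • A) ∈ Algebra.adjoin ℝ {A} := by
    let : NormedRing (Matrix (Fin n) (Fin n) ℝ) := Matrix.linftyOpNormedRing
    let : NormedAlgebra ℝ (Matrix (Fin n) (Fin n) ℝ) := Matrix.linftyOpNormedAlgebra
    have hclosed : IsClosed (Algebra.adjoin ℝ {A} : Set (Matrix (Fin n) (Fin n) ℝ)) :=
      Submodule.closed_of_finiteDimensional (Subalgebra.toSubmodule (Algebra.adjoin ℝ {A}))
    exact NormedSpace.exp_mem (R := ℝ) hclosed
      (Subalgebra.smul_mem _ (Algebra.self_mem_adjoin_singleton ℝ A) t)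
  rw [Algebra.adjoin_singleton_eq_range_aeval] at hmem
  obtain ⟨q, hq⟩ := hmem
  have hdeg : (q %ₘ A.charpoly).degree < n := by
    have := degree_modByMonic_lt q A.charpoly_monic
    rwa [Matrix.charpoly_degree_eq_dim, Fintype.card_fin] at this
  have hr : aeval A (q %ₘ A.charpoly) = aeval A q :=
    aeval_modByMonic_eq_self_of_root (Matrix.aeval_self_charpoly A)
  change aeval A q = _ at hq
  rw [← hq, ← hr, dotProduct_aeval_mulVec_of_degree_lt A B w hdeg]
  simp [h]

lemma vecMul_controllabilityMatrix (j : Fin n) :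
    (w ᵥ* controllabilityMatrix A B) j = w ⬝ᵥ (A ^ (j : ℕ) *ᵥ B) := rfl

/-- A covector annihilating the columns of the controllability matrix annihilates every state
reachable from `0`, so under controllability there is no nonzero one. -/
lemma isUnit_det_controllabilityMatrix (hAB : IsControllable A B) :
    IsUnit (controllabilityMatrix A B).det := by
  rw [isUnit_iff_ne_zero]
  intro hdet
  obtain ⟨v, hv, hv0⟩ := Matrix.exists_vecMul_eq_zero_iff.2 hdet
  have hexp := dotProduct_exp_mulVec_eq_zero A B v fun j => by
    rw [← vecMul_controllabilityMatrix, hv0]; rfl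
  obtain ⟨T, hT, u, hu, h⟩ := hAB 0 v
  rw [Matrix.mulVec_zero, zero_add] at h
  let φ : (Fin n → ℝ) →L[ℝ] ℝ := LinearMap.toContinuousLinearMap (dotProductBilin ℝ ℝ v)
  have hφ : ∀ x, φ x = v ⬝ᵥ x := fun x => rfl
  have hcont : Continuous fun t : ℝ => NormedSpace.exp ((T - t) • A) *ᵥ B := by
    refine continuous_pi fun i => ?_
    have := (continuous_response A B (Pi.single i 1) 1).comp (continuous_const.sub continuous_id)
      (f := fun t : ℝ => T - t)
    simpa [response, Function.comp_def] using this
  have hint : IntervalIntegrable (fun t => u t • (NormedSpace.exp ((T - t) • A) *ᵥ B))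
      volume 0 T := hu.smul_continuousOn hcont.continuousOn
  have := φ.intervalIntegral_comp_comm hint
  rw [h] at this
  simp only [hφ, dotProduct_smul, hexp, smul_zero, intervalIntegral.integral_zero] at this
  exact hv (dotProduct_self_eq_zero.1 this.symm)

variable {A B}

lemma w₁_dotProduct_pow (hP : IsUnit (controllabilityMatrix A B).det) {j : ℕ} (hj : j < n) :
    w₁ A B ⬝ᵥ (A ^ j *ᵥ B) = if j + 1 = n then 1 else 0 := by
  have := vecMul_controllabilityMatrix A B (w₁ A B) ⟨j, hj⟩
  rw [← this, w₁, Matrix.vecMul_vecMul, Matrix.nonsing_inv_mul _ hP, Matrix.vecMul_one]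
  rfl

lemma w₁_dotProduct_aeval (hP : IsUnit (controllabilityMatrix A B).det) (hn : 0 < n)
    {q : ℝ[X]} (hq : q.Monic) (hdeg : q.natDegree = n - 1) :
    w₁ A B ⬝ᵥ (aeval A q *ᵥ B) = 1 := by
  rw [dotProduct_aeval_mulVec_of_degree_lt A B _
    ((natDegree_lt_iff_degree_lt hq.ne_zero).1 (by omega)),
    Finset.sum_eq_single ⟨n - 1, by omega⟩]
  · rw [w₁_dotProduct_pow hP (by simp; omega), if_pos (by simp; omega), mul_one]
    simp only
    rw [← hdeg]; exact hq
  · intro j _ hj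
    rw [w₁_dotProduct_pow hP j.2, if_neg, mul_zero]
    contrapose! hj
    ext; simp; omega
  · simp

/-- The matrix with rows `w₁, w₁ A, …, w₁ A ^ (n - 1)`, that is, the inverse of `Wc A B`. It is the
observability matrix of `A` with output `w₁`. -/
noncomputable def observabilityMatrix (A : Matrix (Fin n) (Fin n) ℝ) (B : Fin n → ℝ) :
    Matrix (Fin n) (Fin n) ℝ :=
  Matrix.of fun i : Fin n => w₁ A B ᵥ* (A ^ (i : ℕ))

lemma observabilityMatrix_mulVec (v : Fin n → ℝ) (i : Fin n) :
    (observabilityMatrix A B *ᵥ v) i = w₁ A B ⬝ᵥ (A ^ (i : ℕ) *ᵥ v) := by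
  rw [Matrix.dotProduct_mulVec]; rfl

lemma isUnit_det_observabilityMatrix (hP : IsUnit (controllabilityMatrix A B).det) :
    IsUnit (observabilityMatrix A B).det := by
  -- the product with the controllability matrix vanishes above the antidiagonal, which is all ones
  set M := observabilityMatrix A B * controllabilityMatrix A B with hM
  have hentry : ∀ i j : Fin n, M i j = w₁ A B ⬝ᵥ (A ^ ((i : ℕ) + j) *ᵥ B) := by
    intro i j
    rw [pow_add, ← Matrix.mulVec_mulVec, ← observabilityMatrix_mulVec]
    rfl
  have htri : (M.submatrix id Fin.revPerm).det = 1 := by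
    rw [Matrix.det_of_isLowerTriangular]
    · refine Finset.prod_eq_one fun i _ => ?_
      rw [Matrix.submatrix_apply, hentry, id, Fin.revPerm_apply, Fin.val_rev,
        w₁_dotProduct_pow hP (by omega), if_pos (by omega)]
    · intro i j hij
      have hij : i < j := by simpa using hij
      rw [Matrix.submatrix_apply, hentry, id, Fin.revPerm_apply, Fin.val_rev,
        w₁_dotProduct_pow hP (by omega), if_neg (by omega)]
  rw [Matrix.det_permute', hM, Matrix.det_mul] at htri
  rw [isUnit_iff_ne_zero]
  intro h
  simp [h] at htri

lemma observabilityMatrix_mulVec_self (hP : IsUnit (controllabilityMatrix A B).det) :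
    observabilityMatrix A B *ᵥ B = lastBasis n := by
  ext i
  rw [observabilityMatrix_mulVec, w₁_dotProduct_pow hP i.2]
  rfl

variable (A B) in
/-- The last row of this identity is the Cayley–Hamilton theorem. -/
lemma observabilityMatrix_mul :
    observabilityMatrix A B * A = Ac A * observabilityMatrix A B := by
  have hrow : ∀ i : Fin n, ∀ k, (observabilityMatrix A B * A) i k =
      (w₁ A B ᵥ* A ^ ((i : ℕ) + 1)) k := by
    intro i k
    rw [pow_succ, ← Matrix.vecMul_vecMul]
    rfl
  ext i k
  rw [hrow, Matrix.mul_apply]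
  by_cases hi : (i : ℕ) + 1 = n
  · have hCH := Matrix.aeval_self_charpoly A
    rw [aeval_eq_sum_range, Matrix.charpoly_natDegree_eq_dim, Fintype.card_fin,
      Finset.sum_range_succ, Finset.sum_range] at hCH
    have hlead : A.charpoly.coeff n = 1 := by
      have := A.charpoly_monic
      rwa [Monic, leadingCoeff, Matrix.charpoly_natDegree_eq_dim, Fintype.card_fin] at this
    rw [hlead, one_smul, add_eq_zero_iff_neg_eq] at hCH
    rw [hi, ← hCH, Matrix.vecMul_neg, Matrix.vecMul_sum]
    simp [Ac, hi, observabilityMatrix, Matrix.vecMul_smul]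
  · have hlt : (i : ℕ) + 1 < n := by omega
    rw [Finset.sum_eq_single ⟨i + 1, hlt⟩]
    · simp [Ac, hi, observabilityMatrix]
    · intro j _ hj
      have : (j : ℕ) ≠ i + 1 := fun h => hj (Fin.ext h)
      simp [Ac, hi, this]
    · simp

end CanonicalForm

/-! ### Orthogonality of solutions of a triangular system -/

lemma integrableOn_mul_of_decay {f g : ℝ → ℝ} (hf : Continuous f) (hg : Continuous g)
    {μ K K' : ℝ} (hμ : 0 < μ) (hK : ∀ t, 0 ≤ t → |f t| ≤ K * Real.exp (-μ * t))
    (hK' : ∀ t, 0 ≤ t → |g t| ≤ K' * Real.exp (-μ * t)) :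
    IntegrableOn (fun t => f t * g t) (Set.Ioi 0) := by
  refine Integrable.mono' ((integrableOn_exp_mul_Ioi (a := -(2 * μ)) (by linarith) 0).const_mul
    (K * K')) (hf.mul hg).aestronglyMeasurable.restrict ?_
  filter_upwards [ae_restrict_mem measurableSet_Ioi] with t ht
  have ht : 0 ≤ t := le_of_lt ht
  rw [Real.norm_eq_abs, abs_mul]
  calc _ ≤ (K * Real.exp (-μ * t)) * (K' * Real.exp (-μ * t)) :=
        mul_le_mul (hK t ht) (hK' t ht) (abs_nonneg _) ((abs_nonneg _).trans (hK t ht))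
    _ = K * K' * (Real.exp (-μ * t) * Real.exp (-μ * t)) := by ring
    _ = _ := by rw [← Real.exp_add]; congr 2; ring

lemma tendsto_zero_of_decay {f : ℝ → ℝ} {μ K : ℝ} (hμ : 0 < μ)
    (hK : ∀ t, 0 ≤ t → |f t| ≤ K * Real.exp (-μ * t)) :
    Filter.Tendsto f Filter.atTop (nhds 0) := by
  have h : Filter.Tendsto (fun t => K * Real.exp (-μ * t)) Filter.atTop (nhds 0) := by
    have : Filter.Tendsto (fun t : ℝ => -μ * t) Filter.atTop Filter.atBot :=
      Filter.tendsto_id.const_mul_atTop_of_neg (by linarith)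
    simpa using (Real.tendsto_exp_atBot.comp this).const_mul K
  refine squeeze_zero_norm' ?_ h
  filter_upwards [Filter.eventually_ge_atTop 0] with t ht using hK t ht

/-- Decaying solutions of the triangular system `g_i' = λ_i g_i + 2 ∑_{j < i} λ_j g_j`, `g_i(0) = 1`,
are orthogonal on `(0, ∞)`. Integrating `(g_i g_j)'` gives linear relations among the inner
products (the entries of a Lyapunov equation), which determine them recursively. -/
lemma gram_of_triangular_ode {n : ℕ} {Λ : Fin n → ℝ} (hneg : ∀ i, Λ i < 0) {g : Fin n → ℝ → ℝ}
    (hd : ∀ i t, HasDerivAt (g i) (Λ i * g i t + ∑ j ∈ Finset.Iio i, 2 * Λ j * g j t) t)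
    (h0 : ∀ i, g i 0 = 1) (hint : ∀ i j, IntegrableOn (fun t => g i t * g j t) (Set.Ioi 0))
    (hlim : ∀ i, Filter.Tendsto (g i) Filter.atTop (nhds 0)) (i j : Fin n) :
    ∫ t in Set.Ioi (0 : ℝ), g i t * g j t = if i = j then 1 / (-2 * Λ i) else 0 := by
  -- The right-hand side is the increment of `g i * g j` from `0` to infinity.
  have key : ∀ i j : Fin n, (Λ i + Λ j) * (∫ t in Set.Ioi (0 : ℝ), g i t * g j t)
      + (∑ k ∈ Finset.Iio i, 2 * Λ k * ∫ t in Set.Ioi (0 : ℝ), g k t * g j t)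
      + (∑ k ∈ Finset.Iio j, 2 * Λ k * ∫ t in Set.Ioi (0 : ℝ), g i t * g k t) = -1 := by
    intro i j
    have hD : ∀ t, HasDerivAt (fun t => g i t * g j t) ((Λ i + Λ j) * (g i t * g j t)
        + (∑ k ∈ Finset.Iio i, 2 * Λ k * (g k t * g j t))
        + (∑ k ∈ Finset.Iio j, 2 * Λ k * (g i t * g k t))) t := by
      intro t
      convert! (hd i t).mul (hd j t) using 1
      have e1 : ∑ k ∈ Finset.Iio i, 2 * Λ k * (g k t * g j t)
          = (∑ k ∈ Finset.Iio i, 2 * Λ k * g k t) * g j t := by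
        rw [Finset.sum_mul]; exact Finset.sum_congr rfl fun k _ => by ring
      have e2 : ∑ k ∈ Finset.Iio j, 2 * Λ k * (g i t * g k t)
          = g i t * (∑ k ∈ Finset.Iio j, 2 * Λ k * g k t) := by
        rw [Finset.mul_sum]; exact Finset.sum_congr rfl fun k _ => by ring
      rw [e1, e2]; ring
    have i1 := (hint i j).const_mul (Λ i + Λ j)
    have i2 : Integrable (fun t => ∑ k ∈ Finset.Iio i, 2 * Λ k * (g k t * g j t))
        (volume.restrict (Set.Ioi 0)) :=
      integrable_finsetSum _ fun k _ => (hint k j).const_mul _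
    have i3 : Integrable (fun t => ∑ k ∈ Finset.Iio j, 2 * Λ k * (g i t * g k t))
        (volume.restrict (Set.Ioi 0)) :=
      integrable_finsetSum _ fun k _ => (hint i k).const_mul _
    have i12 : Integrable (fun t => (Λ i + Λ j) * (g i t * g j t)
        + ∑ k ∈ Finset.Iio i, 2 * Λ k * (g k t * g j t)) (volume.restrict (Set.Ioi 0)) := i1.add i2
    have h := integral_Ioi_of_hasDerivAt_of_tendsto' (a := 0) (fun t _ => hD t)
      (i12.add i3) ((hlim i).mul (hlim j))
    rw [integral_add i12 i3, integral_add i1 i2, integral_const_mul,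
      integral_finsetSum _ (fun k _ => (hint k j).const_mul _),
      integral_finsetSum _ (fun k _ => (hint i k).const_mul _)] at h
    simpa [integral_const_mul, h0] using h
  -- The relation for `(i, j)` involves otherwise only pairs with a smaller sum of indices.
  have main : ∀ N : ℕ, ∀ i j : Fin n, (i : ℕ) + j = N →
      ∫ t in Set.Ioi (0 : ℝ), g i t * g j t = if i = j then 1 / (-2 * Λ i) else 0 := by
    intro N
    induction N using Nat.strong_induction_on with
    | _ N ih =>
      have lt_case : ∀ i j : Fin n, i ≤ j → (i : ℕ) + j = N →
          ∫ t in Set.Ioi (0 : ℝ), g i t * g j t = if i = j then 1 / (-2 * Λ i) else 0 := by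
        intro i j hij hN
        have hk := key i j
        have s1 : ∑ k ∈ Finset.Iio i, 2 * Λ k * ∫ t in Set.Ioi (0 : ℝ), g k t * g j t = 0 := by
          refine Finset.sum_eq_zero fun k hk => ?_
          have hk : k < i := by simpa using hk
          rw [ih _ (by have := Fin.lt_def.1 hk; omega) k j rfl,
            if_neg (hk.trans_le hij).ne, mul_zero]
        have s2 : ∑ k ∈ Finset.Iio j, 2 * Λ k * ∫ t in Set.Ioi (0 : ℝ), g i t * g k t
            = if i = j then 0 else -1 := by
          have : ∀ k ∈ Finset.Iio j, 2 * Λ k * ∫ t in Set.Ioi (0 : ℝ), g i t * g k t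
              = if i = k then -1 else 0 := by
            intro k hk
            have hk : k < j := by simpa using hk
            rw [ih _ (by have := Fin.lt_def.1 hk; omega) i k rfl]
            split_ifs with h
            · subst h
              have := (hneg i).ne
              field_simp
            · simp
          rw [Finset.sum_congr rfl this, Finset.sum_ite_eq]
          rcases hij.eq_or_lt with h | h
          · simp [h]
          · simp [h, h.ne]
        rw [s1, s2] at hk
        split_ifs at hk ⊢ with h
        · subst h
          have := (hneg i).ne
          rw [eq_div_iff (by simpa using this)]
          linarith
        · have : (Λ i + Λ j) * (∫ t in Set.Ioi (0 : ℝ), g i t * g j t) = 0 := by linarith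
          exact (mul_eq_zero.1 this).resolve_left (by linarith [hneg i, hneg j])
      intro i j hN
      rcases le_total i j with h | h
      · exact lt_case i j h hN
      · have := lt_case j i h (by omega)
        simp only [mul_comm (g j _)] at this
        rw [this]
        by_cases hij : j = i
        · simp [hij]
        · rw [if_neg hij, if_neg (Ne.symm hij)]
  exact main _ i j rfl

/-! ### Finite orthonormal families -/

section Orthonormal

variable {n : ℕ} {f : Fin n → ℝ → ℝ} {ν : Measure ℝ}

/-- For an orthonormal family `f`, the Fourier coefficients of `∑ y_j f_j` are the `y_j`. -/
lemma integral_combination_mul (hint : ∀ i j, Integrable (fun t => f i t * f j t) ν)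
    (hgram : ∀ i j, ∫ t, f i t * f j t ∂ν = if i = j then 1 else 0) (y : Fin n → ℝ) (i : Fin n) :
    ∫ t, (∑ j, y j * f j t) * f i t ∂ν = y i := by
  simp only [Finset.sum_mul, mul_assoc]
  rw [integral_finsetSum _ fun j _ => (hint j i).const_mul _]
  simp [integral_const_mul, hgram]

lemma integral_combination_sq (hint : ∀ i j, Integrable (fun t => f i t * f j t) ν)
    (hgram : ∀ i j, ∫ t, f i t * f j t ∂ν = if i = j then 1 else 0) (y : Fin n → ℝ) :
    ∫ t, (∑ j, y j * f j t) ^ 2 ∂ν = ∑ i, y i ^ 2 := by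
  have h : ∀ t, (∑ j, y j * f j t) ^ 2 = ∑ i, y i * ((∑ j, y j * f j t) * f i t) := by
    intro t
    rw [sq, Finset.mul_sum]
    exact Finset.sum_congr rfl fun i _ => by ring
  simp only [h]
  rw [integral_finsetSum]
  · simp only [integral_const_mul, integral_combination_mul hint hgram, sq]
  · intro i _
    refine Integrable.const_mul ?_ _
    simp only [Finset.sum_mul, mul_assoc]
    exact integrable_finsetSum _ fun j _ => (hint j i).const_mul _

lemma bessel_inequality (hf : ∀ i, MemLp (f i) 2 ν)
    (hgram : ∀ i j, ∫ t, f i t * f j t ∂ν = if i = j then 1 else 0) {z : ℝ → ℝ}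
    (hz : MemLp z 2 ν) : ∑ i, (∫ t, z t * f i t ∂ν) ^ 2 ≤ ∫ t, z t ^ 2 ∂ν := by
  have hint : ∀ i j, Integrable (fun t => f i t * f j t) ν := fun i j =>
    (hf i).integrable_mul (hf j)
  set y : Fin n → ℝ := fun i => ∫ t, z t * f i t ∂ν with hy
  have hc : MemLp (fun t => ∑ j, y j * f j t) 2 ν :=
    memLp_finsetSum _ fun j _ => (hf j).const_mul _
  have hzf : ∀ i, Integrable (fun t => y i * (z t * f i t)) ν := fun i =>
    (hz.integrable_mul (hf i)).const_mul _
  have hcross : Integrable (fun t => 2 * ∑ i, y i * (z t * f i t)) ν :=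
    (integrable_finsetSum _ fun i _ => hzf i).const_mul 2
  have h0 : 0 ≤ ∫ t, (z t - ∑ j, y j * f j t) ^ 2 ∂ν := integral_nonneg fun t => sq_nonneg _
  have hexp : ∀ t, (z t - ∑ j, y j * f j t) ^ 2 =
      z t ^ 2 - 2 * ∑ i, y i * (z t * f i t) + (∑ j, y j * f j t) ^ 2 := by
    intro t
    have : ∑ i, y i * (z t * f i t) = z t * ∑ j, y j * f j t := by
      rw [Finset.mul_sum]; exact Finset.sum_congr rfl fun i _ => by ring
    rw [this]; ring
  have hsub : Integrable (fun t => z t ^ 2 - 2 * ∑ i, y i * (z t * f i t)) ν :=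
    hz.integrable_sq.sub hcross
  simp only [hexp] at h0
  rw [integral_add hsub hc.integrable_sq, integral_sub hz.integrable_sq hcross,
    integral_const_mul, integral_finsetSum _ fun i _ => hzf i,
    integral_combination_sq hint hgram] at h0
  have hs : ∑ i, ∫ t, y i * (z t * f i t) ∂ν = ∑ i, y i ^ 2 :=
    Finset.sum_congr rfl fun i _ => by rw [integral_const_mul, sq]
  rw [hs] at h0
  linarith

end Orthonormal

/-! ### Volume of a linear preimage of the Euclidean unit ball -/

lemma volume_sum_sq_le_one (n : ℕ) :
    volume {x : Fin n → ℝ | ∑ i, x i ^ 2 ≤ 1} = ENNReal.ofReal (ballCoeff n) := by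
  rcases n.eq_zero_or_pos with rfl | hn
  · simp [ballCoeff, volume_pi]
  · have : Nonempty (Fin n) := ⟨⟨0, hn⟩⟩
    have h := (PiLp.volume_preserving_toLp (Fin n)).measure_preimage
      (Metric.isClosed_closedBall (x := (0 : EuclideanSpace ℝ (Fin n)))
        (ε := 1)).measurableSet.nullMeasurableSet
    rw [EuclideanSpace.volume_closedBall] at h
    have hset : (WithLp.toLp 2 ⁻¹' Metric.closedBall (0 : EuclideanSpace ℝ (Fin n)) 1) =
        {x : Fin n → ℝ | ∑ i, x i ^ 2 ≤ 1} := by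
      ext x
      simp [EuclideanSpace.norm_eq]
    rw [hset] at h
    rw [h, ballCoeff, Real.sqrt_eq_rpow, ← Real.rpow_natCast, ← Real.rpow_mul Real.pi_pos.le]
    simp
    congr 3
    ring

lemma volume_sum_sq_mulVec_le_one {n : ℕ} {S : Matrix (Fin n) (Fin n) ℝ} (hS : S.det ≠ 0) :
    volume {x : Fin n → ℝ | ∑ i, (S *ᵥ x) i ^ 2 ≤ 1} = ENNReal.ofReal (ballCoeff n / |S.det|) := by
  have h := Measure.addHaar_preimage_linearMap (volume : Measure (Fin n → ℝ))
    (f := Matrix.toLin' S) (by rwa [LinearMap.det_toLin']) {x | ∑ i, x i ^ 2 ≤ 1}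
  rw [LinearMap.det_toLin', volume_sum_sq_le_one, ← ENNReal.ofReal_mul (abs_nonneg _)] at h
  rw [div_eq_inv_mul, ← abs_inv, ← h]
  rfl

/-! ### Balanced coordinates -/

section Balanced

variable {n : ℕ} {A : Matrix (Fin n) (Fin n) ℝ} {B : Fin n → ℝ} {Λ : Fin n → ℝ}


/-- The coordinate change to the input-balanced realization: in the coordinates `S x` the
controllability Gramian is the identity. Its rows are `√(-2 λ_i) w₁ q_i(A)` with
`q_i = balancedPoly Λ i`. -/
noncomputable def balancingMatrix (A : Matrix (Fin n) (Fin n) ℝ) (B Λ : Fin n → ℝ) :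
    Matrix (Fin n) (Fin n) ℝ :=
  Matrix.of fun i => Real.sqrt (-2 * Λ i) • (w₁ A B ᵥ* aeval A (balancedPoly Λ i))

lemma balancingMatrix_mulVec_exp (i : Fin n) (t : ℝ) :
    (balancingMatrix A B Λ *ᵥ (NormedSpace.exp (t • A) *ᵥ B)) i =
      Real.sqrt (-2 * Λ i) * response A B (w₁ A B) (balancedPoly Λ i) t := by
  rw [response, ← Matrix.mulVec_mulVec, Matrix.dotProduct_mulVec]
  change (Real.sqrt (-2 * Λ i) • (w₁ A B ᵥ* aeval A (balancedPoly Λ i))) ⬝ᵥ _ = _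
  rw [smul_dotProduct, smul_eq_mul]

lemma abs_det_balancingMatrix (hneg : ∀ i, Λ i < 0) :
    |(balancingMatrix A B Λ).det| = Real.sqrt (∏ i, (-2 * Λ i)) *
      |∏ i : Fin n, ∏ j ∈ Finset.Ioi i, (Λ i + Λ j)| * |(observabilityMatrix A B).det| := by
  obtain ⟨c, hc, hexp⟩ := exists_balancedPoly_expansion Λ
  have h : balancingMatrix A B Λ = Matrix.diagonal (fun i => Real.sqrt (-2 * Λ i)) *
      (c * (Matrix.of (fun i k : Fin n => (newtonPoly Λ i).coeff k) *
        observabilityMatrix A B)) := by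
    have hN : ∀ m : Fin n, (w₁ A B ᵥ* aeval A (newtonPoly Λ m)) =
        (Matrix.of (fun i k : Fin n => (newtonPoly Λ i).coeff k) * observabilityMatrix A B) m := by
      intro m
      rw [aeval_eq_sum_range' (n := n) (by rw [newtonPoly_natDegree]; omega), Finset.sum_range,
        Matrix.vecMul_sum]
      ext k
      simp [Matrix.mul_apply, observabilityMatrix, Matrix.vecMul_smul]
    ext i k
    rw [Matrix.diagonal_mul, Matrix.mul_apply, balancingMatrix, Matrix.of_apply, hexp, map_sum,
      Matrix.vecMul_sum]
    simp [← hN, Algebra.algebraMap_eq_smul_one, Matrix.vecMul_smul]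
  rw [h, Matrix.det_mul, Matrix.det_mul, Matrix.det_mul, Matrix.det_diagonal, hc, abs_mul, abs_mul,
    abs_mul, abs_det_newtonPoly_coeff, one_mul, mul_assoc,
    ← Real.sqrt_prod _ fun i _ => by linarith [hneg i], abs_of_nonneg (Real.sqrt_nonneg _)]

lemma hasDerivAt_response_balancedPoly (hΛ : A.charpoly = ∏ i : Fin n, (X - C (Λ i)))
    (w : Fin n → ℝ) (i : Fin n) (t : ℝ) :
    HasDerivAt (response A B w (balancedPoly Λ i)) (Λ i * response A B w (balancedPoly Λ i) t +
      ∑ j ∈ Finset.Iio i, 2 * Λ j * response A B w (balancedPoly Λ j) t) t := by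
  convert! hasDerivAt_response A B w (balancedPoly Λ i) t using 1
  have h : balancedPoly Λ i * X = C (Λ i) * balancedPoly Λ i + (A.charpoly +
      ∑ j ∈ Finset.Iio i, C (2 * Λ j) * balancedPoly Λ j) := by
    rw [hΛ, ← balancedPoly_mul_X_sub_C]; ring
  rw [h, response_add, response_add, response_charpoly, response_sum, zero_add]
  simp only [response_C_mul]

lemma memLp_response (hΛ : A.charpoly = ∏ i : Fin n, (X - C (Λ i))) (hneg : ∀ i, Λ i < 0)
    (w : Fin n → ℝ) (q : ℝ[X]) :
    MemLp (response A B w q) 2 (volume.restrict (Set.Ioi 0)) := by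
  obtain ⟨μ, hμ, hrate⟩ := exists_rate hneg
  obtain ⟨K, hK⟩ := response_decay A B w hΛ hrate q
  have hc := continuous_response A B w q
  rw [memLp_two_iff_integrable_sq hc.aestronglyMeasurable.restrict]
  simp only [sq]
  exact integrableOn_mul_of_decay hc hc hμ hK hK

/-- In balanced coordinates the components of `e^{tA} B` are orthonormal in `L²(0, ∞)`. -/
lemma integral_balanced_mul (hP : IsUnit (controllabilityMatrix A B).det)
    (hΛ : A.charpoly = ∏ i : Fin n, (X - C (Λ i))) (hneg : ∀ i, Λ i < 0) (i j : Fin n) :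
    ∫ t in Set.Ioi (0 : ℝ), (balancingMatrix A B Λ *ᵥ (NormedSpace.exp (t • A) *ᵥ B)) i *
      (balancingMatrix A B Λ *ᵥ (NormedSpace.exp (t • A) *ᵥ B)) j = if i = j then 1 else 0 := by
  obtain ⟨μ, hμ, hrate⟩ := exists_rate hneg
  have hgram := gram_of_triangular_ode hneg
    (g := fun i => response A B (w₁ A B) (balancedPoly Λ i))
    (hasDerivAt_response_balancedPoly hΛ _)
    (fun i => by
      rw [response_zero]
      exact w₁_dotProduct_aeval hP i.pos (balancedPoly_monic Λ i) (balancedPoly_natDegree Λ i))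
    (fun i j => (memLp_response hΛ hneg _ _).integrable_mul (memLp_response hΛ hneg _ _))
    (fun i => (response_decay A B _ hΛ hrate _).elim fun K hK => tendsto_zero_of_decay hμ hK) i j
  have hcomm : ∀ t, Real.sqrt (-2 * Λ i) * response A B (w₁ A B) (balancedPoly Λ i) t *
      (Real.sqrt (-2 * Λ j) * response A B (w₁ A B) (balancedPoly Λ j) t) =
      Real.sqrt (-2 * Λ i) * Real.sqrt (-2 * Λ j) *
        (response A B (w₁ A B) (balancedPoly Λ i) t *
          response A B (w₁ A B) (balancedPoly Λ j) t) := fun t => mul_mul_mul_comm _ _ _ _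
  simp only [balancingMatrix_mulVec_exp, hcomm]
  rw [integral_const_mul, hgram]
  split_ifs with h
  · subst h
    have := hneg i
    rw [Real.mul_self_sqrt (by linarith), mul_one_div, div_self (by linarith)]
  · simp

/-- In balanced coordinates the controllability ellipsoid is the Euclidean unit ball: one inclusion
is Bessel's inequality, for the other a state `x` is reached by the input whose Fourier
coefficients are the coordinates of `x`. -/
lemma ellipsoid_eq (hP : IsUnit (controllabilityMatrix A B).det)
    (hΛ : A.charpoly = ∏ i : Fin n, (X - C (Λ i))) (hneg : ∀ i, Λ i < 0)
    (hS : IsUnit (balancingMatrix A B Λ).det) :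
    ellipsoid A B = {x | ∑ i, (balancingMatrix A B Λ *ᵥ x) i ^ 2 ≤ 1} := by
  set S := balancingMatrix A B Λ with hSdef
  set f : Fin n → ℝ → ℝ := fun i t => (S *ᵥ (NormedSpace.exp (t • A) *ᵥ B)) i with hfdef
  have hf : ∀ i, MemLp (f i) 2 (volume.restrict (Set.Ioi 0)) := by
    intro i
    simp only [hfdef, hSdef, balancingMatrix_mulVec_exp]
    exact (memLp_response hΛ hneg _ _).const_mul _
  have hint : ∀ i j, Integrable (fun t => f i t * f j t) (volume.restrict (Set.Ioi 0)) :=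
    fun i j => (hf i).integrable_mul (hf j)
  have hgram : ∀ i j, ∫ t in Set.Ioi (0 : ℝ), f i t * f j t = if i = j then 1 else 0 :=
    integral_balanced_mul hP hΛ hneg
  -- The coordinates of a reachable state are the inner products of the input with the `f i`.
  have hcoord : ∀ z : ℝ → ℝ,
      IntegrableOn (fun t : ℝ => z t • (NormedSpace.exp (t • A) *ᵥ B)) (Set.Ioi 0) → ∀ i,
      (S *ᵥ ∫ t in Set.Ioi (0 : ℝ), z t • (NormedSpace.exp (t • A) *ᵥ B)) i =
        ∫ t in Set.Ioi (0 : ℝ), z t * f i t := by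
    intro z hz i
    let φ : (Fin n → ℝ) →L[ℝ] ℝ :=
      LinearMap.toContinuousLinearMap (LinearMap.proj i ∘ₗ Matrix.toLin' S)
    have hφ : ∀ x, φ x = (S *ᵥ x) i := fun x => rfl
    rw [← hφ, ← φ.integral_comp_comm hz]
    simp only [hφ, hfdef, Matrix.mulVec_smul, Pi.smul_apply, smul_eq_mul]
  ext x
  constructor
  · rintro ⟨z, hz, hz1, hzint, rfl⟩
    change ∑ i, (S *ᵥ _) i ^ 2 ≤ 1
    simp only [hcoord z hzint]
    exact (bessel_inequality hf hgram hz).trans hz1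
  · intro hx
    set z : ℝ → ℝ := fun t => ∑ j, (S *ᵥ x) j * f j t with hzdef
    have hz : MemLp z 2 (volume.restrict (Set.Ioi 0)) :=
      memLp_finsetSum _ fun j _ => (hf j).const_mul _
    have hzint : IntegrableOn (fun t : ℝ => z t • (NormedSpace.exp (t • A) *ᵥ B)) (Set.Ioi 0) := by
      refine Integrable.of_eval fun i => ?_
      have : Integrable (fun t => z t * response A B (Pi.single i 1) 1 t)
          (volume.restrict (Set.Ioi 0)) := hz.integrable_mul (memLp_response hΛ hneg _ _)
      simpa [response] using this
    refine ⟨z, hz, ?_, hzint, ?_⟩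
    · rw [integral_combination_sq hint hgram]
      exact hx
    · apply Matrix.mulVec_injective_iff_isUnit.2 ((Matrix.isUnit_iff_isUnit_det S).2 hS)
      ext i
      rw [hcoord z hzint, integral_combination_mul hint hgram]

end Balanced

end LCT

theorem corollary2 (n : ℕ) (A : Matrix (Fin n) (Fin n) ℝ) (B : Fin n → ℝ)
    (hAB : LCT.IsControllable A B)
    (Λ : Fin n → ℝ) (hΛ : A.charpoly = ∏ i : Fin n, (X - C (Λ i)))
    (hneg : ∀ i, Λ i < 0) :
    (IsUnit (LCT.Wc A B).det ∧
      (LCT.Wc A B)⁻¹ * A * LCT.Wc A B = LCT.Ac A ∧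
      (LCT.Wc A B)⁻¹ *ᵥ B = LCT.lastBasis n) ∧
    A.charpoly.coeff 0 = (-1) ^ n * ∏ i : Fin n, Λ i ∧
    volume (LCT.ellipsoid A B) =
      ENNReal.ofReal (LCT.ballCoeff n * Real.sqrt (A.charpoly.coeff 0 / 2 ^ n) *
        |(LCT.Wc A B).det / LCT.L Λ|) := by
  have hP := LCT.isUnit_det_controllabilityMatrix A B hAB
  have hW := LCT.isUnit_det_observabilityMatrix hP
  have hWc : LCT.Wc A B = (LCT.observabilityMatrix A B)⁻¹ := rfl
  have hWcinv : (LCT.Wc A B)⁻¹ = LCT.observabilityMatrix A B := by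
    rw [hWc, Matrix.nonsing_inv_nonsing_inv _ hW]
  have hcoeff : A.charpoly.coeff 0 = (-1) ^ n * ∏ i : Fin n, Λ i := by
    rw [hΛ, coeff_zero_eq_eval_zero, eval_prod]
    simp [Finset.prod_neg]
  refine ⟨⟨?_, ?_, ?_⟩, hcoeff, ?_⟩
  · rw [hWc]; exact Matrix.isUnit_nonsing_inv_det _ hW
  · rw [hWcinv, LCT.observabilityMatrix_mul, hWc, mul_assoc, Matrix.mul_nonsing_inv _ hW, mul_one]
  · rw [hWcinv, LCT.observabilityMatrix_mulVec_self hP]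
  · set d := ∏ i : Fin n, ∏ j ∈ Finset.Ioi i, (Λ i + Λ j) with hd
    set m := ∏ i : Fin n, -Λ i with hm
    have hmpos : 0 < m := Finset.prod_pos fun i _ => by linarith [hneg i]
    have hd0 : d ≠ 0 := Finset.prod_ne_zero_iff.2 fun i _ => Finset.prod_ne_zero_iff.2 fun j _ =>
      by linarith [hneg i, hneg j]
    have hprod : ∏ i : Fin n, (-2 * Λ i) = 2 ^ n * m := by
      rw [hm, ← Fin.prod_const, ← Finset.prod_mul_distrib]
      exact Finset.prod_congr rfl fun i _ => by ring
    have hm2 : (-1) ^ n * ∏ i : Fin n, Λ i = m := by simp [hm, Finset.prod_neg]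
    have habs : |∏ i : Fin n, Λ i| = m := by
      rw [← abs_of_pos hmpos, ← hm2, abs_mul, abs_pow, abs_neg, abs_one, one_pow, one_mul]
    have hdet := LCT.abs_det_balancingMatrix (A := A) (B := B) hneg
    rw [← hd, hprod] at hdet
    have hS : (LCT.balancingMatrix A B Λ).det ≠ 0 := by
      rw [← abs_pos, hdet]
      have := abs_pos.2 hd0
      have := abs_pos.2 hW.ne_zero
      positivity
    rw [LCT.ellipsoid_eq hP hΛ hneg hS.isUnit, LCT.volume_sum_sq_mulVec_le_one hS, hdet, hcoeff,
      hm2, LCT.L, ← hd, hWc, Matrix.det_nonsing_inv, Ring.inverse_eq_inv', abs_div, abs_mul,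
      habs, abs_inv, Real.sqrt_mul (by positivity), Real.sqrt_div hmpos.le, mul_assoc]
    congr 1
    have h1 : |d| ≠ 0 := (abs_pos.2 hd0).ne'
    have h2 : |(LCT.observabilityMatrix A B).det| ≠ 0 := (abs_pos.2 hW.ne_zero).ne'
    have h3 : Real.sqrt m * Real.sqrt m = m := Real.mul_self_sqrt hmpos.le
    have h4 : Real.sqrt m ≠ 0 := (Real.sqrt_pos.2 hmpos).ne'
    have h5 : Real.sqrt (2 ^ n) ≠ 0 := (Real.sqrt_pos.2 (by positivity)).ne'
    rw [← h3]
    field_simp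
    simp [Real.sq_sqrt hmpos.le]
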